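/- Let $w$ and $\lambda$ be integers with $1\le\lambda\le w$. At an origin, $w$ paths (half-lines) lead off, and $\lambda$ robots stand at the origin. On exactly one of the paths there is a goal, at an unknown distance $n>0$ from the origin. A deterministic exploration algorithm is a joint continuous motion of the $\lambda$ robots on the $w$ paths, starting with all robots at the origin, which is followed until some robot reaches the goal; a randomized exploration algorithm is a random choice of a deterministic one. The cost of an algorithm, for a given position of the goal, is the total distance (for a randomized algorithm: the expected total distance) traveled by all the robots until the goal is found. An algorithm has competitive ratio $c$ if its cost is at most $c\cdot n+o(n)$ as $n\to\infty$, whichever path contains the goal. Let $D(w,\lambda)$ and $R(w,\lambda)$ be the smallest (infimal) competitive ratios of deterministic and of randomized exploration algorithms, respectively, for $w$ paths and $\lambda$ robots. Corollary (randomization helps if and only if $\lambda<w$). $D(w,\lambda)$ is finite, and $$R(w,\lambda)<D(w,\lambda)\quad\Longleftrightarrow\quad\lambda<w .$$ In particular, if $\lambda<w$, then the smallest competitive ratio of randomized exploration algorithms is strictly smaller than that of deterministic ones. -/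

import Mathlib

open scoped NNReal ENNReal

/-- A deterministic exploration algorithm for `lam` robots on `w` paths (half-lines `[0, ∞)`
glued together at the origin).  As long as the goal has not been found the robots learn nothing,
so the algorithm is the joint motion that the robots follow until then.
`pos k t p` is the distance of robot `k` from the origin along path `p` at time `t`; it is `0` when
the robot is at the origin or on another path.  The motion is an arbitrary continuous one:
robots may move one at a time or in parallel, and may turn anywhere. -/
structure Exploration (w lam : ℕ) where
  pos : Fin lam → ℝ≥0 → Fin w → ℝ
  pos_nonneg : ∀ k t p, 0 ≤ pos k t p
  /-- a robot away from the origin is on exactly one path -/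
  path_unique : ∀ k t p q, 0 < pos k t p → 0 < pos k t q → p = q
  continuous_pos : ∀ k, Continuous (pos k)
  /-- all robots start at the origin -/
  start : ∀ k p, pos k 0 p = 0

namespace Exploration

variable {w lam : ℕ}

/-- The total distance traveled by all the robots up to time `t`: for every robot and every path,
the total variation on `[0, t]` of the robot's distance from the origin along that path. -/
noncomputable def traveled (A : Exploration w lam) (t : ℝ≥0) : ℝ≥0∞ :=
  ∑ k : Fin lam, ∑ p : Fin w, eVariationOn (fun s => A.pos k s p) (Set.Iic t)

/-- The total distance traveled by all the robots before the goal at distance `n` on path `p` is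
found, that is, up to the first time at which some robot stands at the goal (`traveled` is monotone
in time, so this is the infimum over all such times); it is `∞` if the goal is never found. -/
noncomputable def cost (A : Exploration w lam) (p : Fin w) (n : ℝ) : ℝ≥0∞ :=
  ⨅ (t : ℝ≥0) (_ : ∃ k, A.pos k t p = n), A.traveled t

end Exploration

/-- A randomized exploration algorithm: a deterministic one chosen at random, where the position of
every robot at every time is a random variable. -/
structure RandomizedExploration (w lam : ℕ) where
  Ω : Type
  mΩ : MeasurableSpace Ω
  prob : MeasureTheory.Measure Ω
  isProbability : MeasureTheory.IsProbabilityMeasure prob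
  run : Ω → Exploration w lam
  measurable_pos : ∀ k t p, Measurable (fun ω => (run ω).pos k t p)

/-- The expected total distance traveled before the goal at distance `n` on path `p` is found. -/
noncomputable def RandomizedExploration.cost {w lam : ℕ} (A : RandomizedExploration w lam)
    (p : Fin w) (n : ℝ) : ℝ≥0∞ :=
  letI := A.mΩ
  ∫⁻ ω, (A.run ω).cost p n ∂A.prob

/-- `cost p n ≤ c * n + o(n)`, wherever the goal is: the competitive ratio `c` is achieved. -/
def HasCompetitiveRatio {w : ℕ} (cost : Fin w → ℝ → ℝ≥0∞) (c : ℝ≥0) : Prop :=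
  ∃ e : ℝ → ℝ, Asymptotics.IsLittleO Filter.atTop e (fun n : ℝ => n) ∧
    ∀ (p : Fin w) (n : ℝ), 0 < n → cost p n ≤ ENNReal.ofReal (c * n + e n)

/-- The smallest (infimal) competitive ratio of deterministic exploration algorithms. -/
noncomputable def deterministicRatio (w lam : ℕ) : ℝ≥0∞ :=
  ⨅ (c : ℝ≥0) (_ : ∃ A : Exploration w lam, HasCompetitiveRatio A.cost c), (c : ℝ≥0∞)

/-- The smallest (infimal) competitive ratio of randomized exploration algorithms. -/
noncomputable def randomizedRatio (w lam : ℕ) : ℝ≥0∞ :=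
  ⨅ (c : ℝ≥0) (_ : ∃ A : RandomizedExploration w lam, HasCompetitiveRatio A.cost c), (c : ℝ≥0∞)

/-! Finiteness comes from `Exploration.doubling`. For `lam < w`, take a deterministic algorithm of
ratio `c` close to the optimum `D` and randomize it by a cyclic shift of the paths and a scale `q⁻¹
^ j`, `j ≤ m`. The expected cost is at most the average of the costs at `q ^ j * n` divided by `q ^
j`, each at most `c * n + o(n)`. One of them is smaller: when all paths are explored up to `n`, some
path is deserted, and a robot must start again from the origin to go further on it
(`exists_cost_add_le`), so some normalized cost is at most about `(c - 1) * q * n`. The number of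
terms depends only on `w` and `D`, so the gain is a fixed amount, which exceeds `c - D` once `c` is
close enough to `D` (`randomizedRatio_le_sub`).

For `lam = w`, one robot per path gives ratio `w`, and no randomized algorithm does better, for any
number of robots (`natCast_le_randomizedRatio`). The cost is at least the sum over all paths of the
lengths explored. Average cost/distance over goals on all paths at geometric distances: by `1 + x ≤
exp x` it suffices that the logarithms of explored length and of goal distance agree on average, up
to a small error. This holds because, of any two (path, scale) pairs, one is passed no later than
the other. -/

open MeasureTheory

/-! ### Distance traveled, cost, and rescaling -/

namespace Exploration

variable {w lam : ℕ}

theorem traveled_mono (A : Exploration w lam) {s t : ℝ≥0} (h : s ≤ t) :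
    A.traveled s ≤ A.traveled t :=
  Finset.sum_le_sum fun _ _ => Finset.sum_le_sum fun _ _ =>
    eVariationOn.mono _ (Set.Iic_subset_Iic.2 h)

/-- Travel on distinct paths adds up, and on each path the variation is at least the distance
reached from the start at `0`. The alternative `f p ≤ 0` serves paths about which nothing is known.
-/
theorem sum_le_traveled (A : Exploration w lam) (t : ℝ≥0) (f : Fin w → ℝ)
    (h : ∀ p, f p ≤ 0 ∨ ∃ s ≤ t, ∃ k, f p ≤ A.pos k s p) :
    ∑ p, ENNReal.ofReal (f p) ≤ A.traveled t := by
  rw [traveled, Finset.sum_comm]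
  refine Finset.sum_le_sum fun p _ => ?_
  rcases h p with h0 | ⟨s, hs, k, hk⟩
  · simp [ENNReal.ofReal_of_nonpos h0]
  · calc ENNReal.ofReal (f p) ≤ ENNReal.ofReal (A.pos k s p) := ENNReal.ofReal_le_ofReal hk
      _ = edist (A.pos k s p) (A.pos k 0 p) := by
        rw [A.start, edist_dist, Real.dist_eq, sub_zero, abs_of_nonneg (A.pos_nonneg k s p)]
      _ ≤ eVariationOn (fun s => A.pos k s p) (Set.Iic t) :=
        eVariationOn.edist_le (fun s => A.pos k s p) hs (zero_le (a := t))
      _ ≤ _ := Finset.single_le_sum (f := fun k => eVariationOn (fun s => A.pos k s p) (Set.Iic t))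
        (fun _ _ => zero_le) (Finset.mem_univ k)

theorem ofReal_pos_le_traveled (A : Exploration w lam) (k : Fin lam) (t : ℝ≥0) (p : Fin w) :
    ENNReal.ofReal (A.pos k t p) ≤ A.traveled t := by
  refine le_trans ?_ (A.sum_le_traveled t (fun p' => if p' = p then A.pos k t p else 0) ?_)
  · refine le_trans (le_of_eq ?_) (Finset.single_le_sum (fun _ _ => zero_le) (Finset.mem_univ p))
    simp
  · intro p'
    by_cases h : p' = p
    · exact Or.inr ⟨t, le_rfl, k, by simp [h]⟩
    · exact Or.inl (by simp [h])

theorem ofReal_le_cost (A : Exploration w lam) (p : Fin w) (n : ℝ) :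
    ENNReal.ofReal n ≤ A.cost p n :=
  le_iInf₂ fun t ⟨k, hk⟩ => hk ▸ A.ofReal_pos_le_traveled k t p

/-- A robot which is off path `p` at time `s` has to walk all the way along `p` afterwards. -/
theorem traveled_add_le (A : Exploration w lam) {s t : ℝ≥0} (hst : s ≤ t) (k : Fin lam)
    (p : Fin w) (h0 : A.pos k s p = 0) :
    A.traveled s + ENNReal.ofReal (A.pos k t p) ≤ A.traveled t := by
  have key : ∀ k p, eVariationOn (fun s => A.pos k s p) (Set.Iic s) +
      eVariationOn (fun s => A.pos k s p) (Set.Icc s t) ≤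
      eVariationOn (fun s => A.pos k s p) (Set.Iic t) := fun k p =>
    (eVariationOn.add_le_union _ fun x hx y hy => le_trans hx hy.1).trans
      (eVariationOn.mono _ (Set.union_subset (Set.Iic_subset_Iic.2 hst) fun x hx => hx.2))
  have h1 : ENNReal.ofReal (A.pos k t p) ≤
      ∑ k, ∑ p, eVariationOn (fun s => A.pos k s p) (Set.Icc s t) := by
    calc ENNReal.ofReal (A.pos k t p) = edist (A.pos k t p) (A.pos k s p) := by
          rw [h0, edist_dist, Real.dist_eq, sub_zero, abs_of_nonneg (A.pos_nonneg k t p)]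
      _ ≤ eVariationOn (fun s => A.pos k s p) (Set.Icc s t) :=
        eVariationOn.edist_le (fun s => A.pos k s p) ⟨hst, le_rfl⟩ ⟨le_rfl, hst⟩
      _ ≤ ∑ p, eVariationOn (fun s => A.pos k s p) (Set.Icc s t) :=
        Finset.single_le_sum (f := fun p => eVariationOn (fun s => A.pos k s p) (Set.Icc s t))
          (fun _ _ => zero_le) (Finset.mem_univ p)
      _ ≤ _ := Finset.single_le_sum
          (f := fun k => ∑ p, eVariationOn (fun s => A.pos k s p) (Set.Icc s t))
          (fun _ _ => zero_le) (Finset.mem_univ k)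
  calc _ ≤ _ := add_le_add_right h1 _
    _ = ∑ k, ∑ p, (eVariationOn (fun s => A.pos k s p) (Set.Iic s) +
      eVariationOn (fun s => A.pos k s p) (Set.Icc s t)) := by
        simp only [traveled, Finset.sum_add_distrib]
    _ ≤ _ := Finset.sum_le_sum fun k _ => Finset.sum_le_sum fun p _ => key k p

theorem continuous_pos_apply (A : Exploration w lam) (k : Fin lam) (p : Fin w) :
    Continuous fun t => A.pos k t p :=
  (continuous_apply p).comp (A.continuous_pos k)

/-- By continuity the times at which a robot stands at the goal form a closed set, so the infimum in
`cost` is attained at the first of them. -/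
theorem exists_isLeast_found (A : Exploration w lam) (p : Fin w) (n : ℝ) (h : A.cost p n ≠ ⊤) :
    ∃ T, IsLeast {t | ∃ k, A.pos k t p = n} T ∧ A.cost p n = A.traveled T := by
  have hne : {t | ∃ k, A.pos k t p = n}.Nonempty := by
    by_contra hne
    rw [Set.not_nonempty_iff_eq_empty] at hne
    refine h (iInf₂_eq_top.2 fun t ht => ?_)
    exact absurd (show t ∈ {t | ∃ k, A.pos k t p = n} from ht) (by simp [hne])
  have hcl : IsClosed {t | ∃ k, A.pos k t p = n} := by
    rw [Set.ofPred_exists]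
    exact isClosed_iUnion_of_finite fun k =>
      isClosed_eq (A.continuous_pos_apply k p) continuous_const
  have hT : IsLeast {t | ∃ k, A.pos k t p = n} (sInf {t | ∃ k, A.pos k t p = n}) :=
    ⟨hcl.csInf_mem hne (OrderBot.bddBelow _), fun t ht => csInf_le (OrderBot.bddBelow _) ht⟩
  exact ⟨_, hT, le_antisymm (iInf₂_le _ hT.1)
    (le_iInf₂ fun t ht => A.traveled_mono (hT.2 ht))⟩

/-- If there are fewer robots than paths, then at the time when all paths have been explored up to
`x 0` some path is deserted, and exploring it later requires returning from the origin. -/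
theorem exists_cost_add_le (A : Exploration w lam) (hw : lam < w) (x : ℕ → ℝ) (m : ℕ)
    (hfin : ∀ p i, A.cost p (x i) ≠ ⊤)
    (hm : ∀ p, A.cost p (x 0) < ENNReal.ofReal (x m)) :
    ∃ p, ∃ i < m, A.cost p (x i) + ENNReal.ofReal (x (i + 1)) ≤ A.cost p (x (i + 1)) := by
  choose T hT hcost using fun p i => A.exists_isLeast_found p (x i) (hfin p i)
  have : Nonempty (Fin w) := ⟨⟨0, by omega⟩⟩
  obtain ⟨p₀, hp₀⟩ := Finite.exists_max fun p => T p 0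
  set t := T p₀ 0
  -- Pigeonhole: a robot occupies at most one path.
  obtain ⟨p, hp⟩ : ∃ p, ∀ k, A.pos k t p = 0 := by
    by_contra! hcon
    choose f hf using hcon
    have : Function.Injective f := fun p q hpq =>
      A.path_unique (f p) t p q (lt_of_le_of_ne (A.pos_nonneg _ _ _) (hf p).symm)
        (lt_of_le_of_ne (A.pos_nonneg _ _ _) (by rw [hpq]; exact (hf q).symm))
    have := Fintype.card_le_of_injective f this
    simp at this
    omega
  -- Reaching `x m` takes total travel at least `x m`, more than has been done by time `t`.
  have hlast : t < T p m := by
    by_contra! hle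
    obtain ⟨k, hk⟩ := (hT p m).1
    have h1 := A.ofReal_pos_le_traveled k (T p m) p
    rw [hk] at h1
    have h2 := A.traveled_mono hle
    rw [← hcost p₀ 0] at h2
    exact absurd (h1.trans h2) (not_le.2 (hm p₀))
  obtain ⟨i, him, hi, hi'⟩ : ∃ i < m, T p i ≤ t ∧ t < T p (i + 1) := by
    by_contra! hcon
    have : ∀ i ≤ m, T p i ≤ t := by
      intro i
      induction i with
      | zero => exact fun _ => hp₀ p
      | succ i ih => exact fun h => hcon i (by omega) (ih (by omega))
    exact absurd (this m le_rfl) (not_le.2 hlast)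
  refine ⟨p, i, him, ?_⟩
  obtain ⟨k, hk⟩ := (hT p (i + 1)).1
  rw [hcost, hcost]
  calc _ ≤ A.traveled t + ENNReal.ofReal (x (i + 1)) := add_le_add_left (A.traveled_mono hi) _
    _ ≤ _ := hk ▸ A.traveled_add_le hi'.le k p (hp k)

/-- The same motion on relabelled paths, with all distances multiplied by `a`. -/
@[simps] def rescale (A : Exploration w lam) (a : ℝ≥0) (σ : Equiv.Perm (Fin w)) :
    Exploration w lam where
  pos k t p := a * A.pos k t (σ p)
  pos_nonneg k t p := mul_nonneg a.2 (A.pos_nonneg _ _ _)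
  path_unique k t p q hp hq := σ.injective (A.path_unique k t _ _
    (pos_of_mul_pos_right hp a.2) (pos_of_mul_pos_right hq a.2))
  continuous_pos k := continuous_pi fun p => continuous_const.mul (A.continuous_pos_apply k _)
  start k p := by simp [A.start]

theorem traveled_rescale_le (A : Exploration w lam) (a : ℝ≥0) (σ : Equiv.Perm (Fin w)) (t : ℝ≥0) :
    (A.rescale a σ).traveled t ≤ a * A.traveled t := by
  simp only [traveled, Finset.mul_sum]
  refine Finset.sum_le_sum fun k _ => ?_
  rw [← Equiv.sum_comp σ (fun p => (a : ℝ≥0∞) * eVariationOn (fun s => A.pos k s p) (Set.Iic t))]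
  refine Finset.sum_le_sum fun p _ => ?_
  have : LipschitzWith a (fun y : ℝ => (a : ℝ) * y) := by
    refine LipschitzWith.of_dist_le_mul fun y z => ?_
    rw [Real.dist_eq, Real.dist_eq, ← mul_sub, abs_mul, NNReal.abs_eq]
  exact (this.lipschitzOnWith (s := Set.univ)).comp_eVariationOn_le (Set.mapsTo_univ _ _)

theorem cost_rescale_le (A : Exploration w lam) (a : ℝ≥0) (σ : Equiv.Perm (Fin w)) (p : Fin w)
    (n : ℝ) (h : A.cost (σ p) n ≠ ⊤) :
    (A.rescale a σ).cost p (a * n) ≤ a * A.cost (σ p) n := by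
  obtain ⟨T, hT, hc⟩ := A.exists_isLeast_found _ _ h
  obtain ⟨k, hk⟩ := hT.1
  rw [hc]
  exact (iInf₂_le T ⟨k, by simp [hk]⟩).trans (A.traveled_rescale_le a σ T)

end Exploration

/-! ### Explicit deterministic algorithms -/

theorem eVariationOn_coe_Iic_le (t : ℝ≥0) :
    eVariationOn (fun s : ℝ≥0 => (s : ℝ)) (Set.Iic t) ≤ t := by
  have h := MonotoneOn.eVariationOn_eq (f := fun s : ℝ≥0 => (s : ℝ)) (s := Set.Iic t)
    (fun x _ y _ hxy => NNReal.coe_le_coe.2 hxy) (a := 0) (b := t)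
    (Set.mem_Iic.2 zero_le) (Set.mem_Iic.2 le_rfl)
  simp only [NNReal.coe_zero, sub_zero, ENNReal.ofReal_coe_nnreal] at h
  have hsub : Set.Iic t ⊆ Set.Iic t ∩ Set.Icc 0 t := fun x hx => ⟨hx, zero_le, hx⟩
  exact (eVariationOn.mono _ hsub).trans h.le

theorem eVariationOn_Iic_le_of_lipschitzWith {f : ℝ≥0 → ℝ} (hf : LipschitzWith 1 f) (t : ℝ≥0) :
    eVariationOn f (Set.Iic t) ≤ t := by
  have h := (hf.lipschitzOnWith (s := Set.univ)).comp_eVariationOn_le (f := f) (g := id)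
    (Set.mapsTo_univ id (Set.Iic t))
  rw [Function.comp_id, ENNReal.coe_one, one_mul] at h
  refine h.trans (le_trans (le_of_eq ?_) (eVariationOn_coe_Iic_le t))
  simp only [eVariationOn, edist_dist, NNReal.dist_eq, Real.dist_eq, id]

/-- Each robot walks straight on a path of its own. -/
noncomputable def Exploration.straight (w : ℕ) : Exploration w w where
  pos k t p := if k = p then t else 0
  pos_nonneg k t p := by split_ifs <;> simp
  path_unique k t p q hp hq := by
    have h1 : k = p := by by_contra h; simp [h] at hp
    have h2 : k = q := by by_contra h; simp [h] at hq
    exact h1 ▸ h2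
  continuous_pos k := continuous_pi fun p => by
    split_ifs
    · exact NNReal.continuous_coe
    · exact continuous_const
  start k p := by simp

theorem Exploration.cost_straight_le (w : ℕ) (p : Fin w) {n : ℝ} (hn : 0 < n) :
    (Exploration.straight w).cost p n ≤ ENNReal.ofReal (w * n) := by
  refine (iInf₂_le n.toNNReal ⟨p, by simp [straight, hn.le]⟩).trans ?_
  have : ∀ k p : Fin w, eVariationOn (fun s => (Exploration.straight w).pos k s p)
      (Set.Iic n.toNNReal) ≤ if k = p then ENNReal.ofReal n else 0 := by
    intro k p
    by_cases h : k = p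
    · simpa [straight, h, ENNReal.ofReal] using eVariationOn_coe_Iic_le n.toNNReal
    · simp only [straight, h, if_false]
      exact le_of_eq (eVariationOn.constant_on (by
        rintro _ ⟨x, -, rfl⟩ _ ⟨y, -, rfl⟩; rfl))
  refine (Finset.sum_le_sum fun k _ => Finset.sum_le_sum fun p _ => this k p).trans ?_
  simp [ENNReal.ofReal_mul]

theorem deterministicRatio_self_le (w : ℕ) : deterministicRatio w w ≤ w := by
  have : ((w : ℝ≥0) : ℝ≥0∞) = w := by simp
  rw [← this]
  refine iInf₂_le _ ⟨Exploration.straight w, fun _ => 0, Asymptotics.isLittleO_zero _ _,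
    fun p n hn => ?_⟩
  simpa using Exploration.cost_straight_le w p hn

/-- The time intervals `(2 ^ k, 2 ^ (k + 1))` with `k ≡ p` modulo `w`. -/
def dyadicSlots (w p : ℕ) : Set ℝ≥0 :=
  ⋃ (k : ℕ) (_ : k % w = p), Set.Ioo (2 ^ k) (2 ^ (k + 1))

theorem dyadicSlots_unique {w p q : ℕ} {t : ℝ≥0} (hp : t ∈ dyadicSlots w p)
    (hq : t ∈ dyadicSlots w q) : p = q := by
  simp only [dyadicSlots, Set.mem_iUnion] at hp hq
  obtain ⟨k, rfl, hk⟩ := hp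
  obtain ⟨l, rfl, hl⟩ := hq
  have h1 : k < l + 1 := (pow_lt_pow_iff_right₀ (by norm_num : (1 : ℝ≥0) < 2)).1 (hk.1.trans hl.2)
  have h2 : l < k + 1 := (pow_lt_pow_iff_right₀ (by norm_num : (1 : ℝ≥0) < 2)).1 (hl.1.trans hk.2)
  rw [show k = l by omega]

theorem zero_notMem_dyadicSlots (w p : ℕ) : (0 : ℝ≥0) ∉ dyadicSlots w p := by
  simp [dyadicSlots]

/-- All robots together explore the paths cyclically, as far as `2 ^ k` in the `k`-th round. -/
noncomputable def Exploration.doubling (w lam : ℕ) : Exploration w lam where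
  pos _ t p := Metric.infDist t (dyadicSlots w p)ᶜ
  pos_nonneg _ _ _ := Metric.infDist_nonneg
  path_unique _ t p q hp hq := by
    have key : ∀ p : Fin w, 0 < Metric.infDist t (dyadicSlots w p)ᶜ → t ∈ dyadicSlots w p := by
      intro p hp
      by_contra h
      exact hp.ne' (Metric.infDist_zero_of_mem h)
    exact Fin.ext (dyadicSlots_unique (key p hp) (key q hq))
  continuous_pos _ := continuous_pi fun _ => Metric.continuous_infDist_pt _
  start _ p := Metric.infDist_zero_of_mem (zero_notMem_dyadicSlots w p)

theorem Exploration.traveled_doubling_le (w lam : ℕ) (t : ℝ≥0) :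
    (Exploration.doubling w lam).traveled t ≤ lam * (w * t) := by
  refine (Finset.sum_le_sum fun k _ => Finset.sum_le_sum fun p _ =>
    eVariationOn_Iic_le_of_lipschitzWith (Metric.lipschitz_infDist_pt _) t).trans ?_
  simp

theorem Exploration.cost_doubling_le {w lam : ℕ} (hlam : 1 ≤ lam) (p : Fin w) {n : ℝ} {k : ℕ}
    (hn : 0 < n) (hk : (k + 1) % w = p) (hnk : n ≤ 2 ^ k) :
    (Exploration.doubling w lam).cost p n ≤ lam * (w * (3 * 2 ^ k)) := by
  set A := Exploration.doubling w lam
  let r : Fin lam := ⟨0, hlam⟩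
  -- `3 * 2 ^ k` is the midpoint of slot `k + 1`, whose half-length is `2 ^ k`.
  have hfar : (2 : ℝ) ^ k ≤ A.pos r (3 * 2 ^ k) p := by
    refine (Metric.le_infDist ⟨0, zero_notMem_dyadicSlots w p⟩).2 fun y hy => ?_
    by_contra! hlt
    refine hy ?_
    rw [NNReal.dist_eq, abs_lt] at hlt
    push_cast at hlt
    simp only [dyadicSlots, Set.mem_iUnion]
    refine ⟨k + 1, hk, ?_, ?_⟩
    · rw [← NNReal.coe_lt_coe]; push_cast; rw [pow_succ]; linarith
    · rw [← NNReal.coe_lt_coe]; push_cast; rw [pow_succ, pow_succ]; linarith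
  obtain ⟨t, ht, hpos⟩ := intermediate_value_Icc (zero_le (a := (3 * 2 ^ k : ℝ≥0)))
    (A.continuous_pos_apply r p).continuousOn (show n ∈ Set.Icc _ _ from
      ⟨by simpa [A.start] using hn.le, hnk.trans hfar⟩)
  refine (iInf₂_le t ⟨r, hpos⟩).trans ((A.traveled_mono ht.2).trans ?_)
  simpa using Exploration.traveled_doubling_le w lam (3 * 2 ^ k)

theorem deterministicRatio_lt_top {w lam : ℕ} (hlam : 1 ≤ lam) (hw : 1 ≤ w) :
    deterministicRatio w lam < ⊤ := by
  set c : ℝ≥0 := lam * (w * (3 * (2 ^ w * 2)))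
  refine lt_of_le_of_lt (iInf₂_le c ⟨Exploration.doubling w lam, fun _ => c, ?_, ?_⟩)
    ENNReal.coe_lt_top
  · exact Asymptotics.isLittleO_const_id_atTop _
  intro p n hn
  obtain ⟨N, hN, hN'⟩ := exists_nat_pow_near (x := max n 1) (le_max_right _ _) one_lt_two
  set j := (p + (w - 1) * (N + 2)) % w
  have hj : j < w := Nat.mod_lt _ hw
  have hmod : (N + 1 + j + 1) % w = p := by
    have h1 : N + 1 + j + 1 ≡ (N + 2) + (p + (w - 1) * (N + 2)) [MOD w] := by
      rw [show N + 1 + j + 1 = (N + 2) + j by ring]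
      exact Nat.ModEq.add_left _ (Nat.mod_modEq _ _)
    have h2 : (N + 2) + (p + (w - 1) * (N + 2)) = p + w * (N + 2) := by
      obtain ⟨v, rfl⟩ : ∃ v, w = v + 1 := ⟨w - 1, by omega⟩
      simp only [Nat.add_sub_cancel]
      ring
    rw [h2] at h1
    have h3 : p + w * (N + 2) ≡ p [MOD w] := by simp [Nat.ModEq]
    have h4 : (N + 1 + j + 1) % w = (p : ℕ) % w := h1.trans h3
    rw [h4, Nat.mod_eq_of_lt p.2]
  have hle : (2 : ℝ) ^ (N + 1) ≤ 2 ^ (N + 1 + j) := pow_le_pow_right₀ one_le_two (by omega)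
  refine (Exploration.cost_doubling_le hlam p hn hmod
    ((le_max_left _ _).trans (hN'.le.trans hle))).trans ?_
  have hpow : (2 : ℝ) ^ (N + 1 + j) ≤ 2 ^ w * 2 * (n + 1) := by
    calc (2 : ℝ) ^ (N + 1 + j) ≤ 2 ^ (N + 1 + w) := pow_le_pow_right₀ one_le_two (by omega)
      _ = 2 ^ w * 2 * 2 ^ N := by ring
      _ ≤ 2 ^ w * 2 * (n + 1) := by
        gcongr
        exact hN.trans (max_le (by linarith) (by linarith))
  have hcast : (lam * (w * (3 * 2 ^ (N + 1 + j))) : ℝ≥0∞) =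
      ENNReal.ofReal (lam * (w * (3 * 2 ^ (N + 1 + j)))) := by
    simp [ENNReal.ofReal_mul, ENNReal.ofReal_pow]
  rw [hcast]
  refine ENNReal.ofReal_le_ofReal ?_
  calc (lam * (w * (3 * 2 ^ (N + 1 + j))) : ℝ) ≤ lam * (w * (3 * (2 ^ w * 2 * (n + 1)))) := by
        gcongr
    _ = c * n + c := by simp only [c]; push_cast; ring

/-! ### Fewer robots than paths: randomization helps -/

/-- A deterministic algorithm on uniformly random relabelled paths and at a random scale. -/
noncomputable def Exploration.shuffle {w lam : ℕ} (A : Exploration (w + 1) lam) (m : ℕ) (a : ℝ≥0) :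
    RandomizedExploration (w + 1) lam where
  Ω := Fin (w + 1) × Fin (m + 1)
  mΩ := ⊤
  prob := letI : MeasurableSpace (Fin (w + 1) × Fin (m + 1)) := ⊤
    (((w + 1) * (m + 1) : ℕ) : ℝ≥0∞)⁻¹ • Measure.count
  isProbability := by
    let _ : MeasurableSpace (Fin (w + 1) × Fin (m + 1)) := ⊤
    constructor
    rw [Measure.smul_apply, Measure.count_univ, smul_eq_mul]
    simp only [ENat.card_eq_coe_fintype_card, Fintype.card_prod, Fintype.card_fin]
    exact ENNReal.inv_mul_cancel (by simp) (ENNReal.natCast_ne_top _)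
  run ω := A.rescale (a ^ (ω.2 : ℕ)) (Equiv.addRight ω.1)
  measurable_pos k t p := measurable_from_top

/-- The bound is the same for every `p` because the cyclic shifts carry `p` to each path exactly
once. -/
theorem Exploration.cost_shuffle_le {w lam : ℕ} (A : Exploration (w + 1) lam) (m : ℕ) (a : ℝ≥0)
    (ha : 0 < a) (p : Fin (w + 1)) (n : ℝ) (hfin : ∀ p i, A.cost p ((a⁻¹ : ℝ≥0) ^ i * n) ≠ ⊤) :
    (A.shuffle m a).cost p n ≤ (((w + 1) * (m + 1) : ℕ) : ℝ≥0∞)⁻¹ *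
      ∑ p, ∑ i ∈ Finset.range (m + 1), (a ^ i : ℝ≥0) * A.cost p ((a⁻¹ : ℝ≥0) ^ i * n) := by
  let _ : MeasurableSpace (Fin (w + 1) × Fin (m + 1)) := ⊤
  have : (A.shuffle m a).cost p n = ∫⁻ ω : Fin (w + 1) × Fin (m + 1),
      (A.rescale (a ^ (ω.2 : ℕ)) (Equiv.addRight ω.1)).cost p n
        ∂((((w + 1) * (m + 1) : ℕ) : ℝ≥0∞)⁻¹ • Measure.count) := rfl
  rw [this, lintegral_smul_measure, lintegral_count, tsum_fintype, smul_eq_mul]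
  refine mul_le_mul_right ?_ _
  rw [Fintype.sum_prod_type, ← Equiv.sum_comp (Equiv.addLeft p) (fun s => ∑ i ∈ Finset.range (m + 1),
    ((a ^ i : ℝ≥0) : ℝ≥0∞) * A.cost s ((a⁻¹ : ℝ≥0) ^ i * n))]
  refine Finset.sum_le_sum fun s _ => ?_
  rw [← Fin.sum_univ_eq_sum_range
    (fun i => ((a ^ i : ℝ≥0) : ℝ≥0∞) * A.cost (Equiv.addLeft p s) ((a⁻¹ : ℝ≥0) ^ i * n))]
  refine Finset.sum_le_sum fun i _ => ?_
  have h := A.cost_rescale_le (a ^ (i : ℕ)) (Equiv.addRight s) p ((a⁻¹ : ℝ≥0) ^ (i : ℕ) * n)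
    (hfin _ _)
  have h1 : ((a ^ (i : ℕ) : ℝ≥0) : ℝ) * (((a⁻¹ : ℝ≥0) : ℝ) ^ (i : ℕ) * n) = n := by
    have : (a : ℝ) ≠ 0 := by exact_mod_cast ha.ne'
    push_cast
    rw [← mul_assoc, ← mul_pow, mul_inv_cancel₀ this, one_pow, one_mul]
  rw [h1] at h
  exact h

/-- A robot must walk at least `n` to reach the goal. This keeps the deterministic ratio positive.
-/
theorem one_le_of_hasCompetitiveRatio {w lam : ℕ} (A : Exploration w lam) (p : Fin w) {c : ℝ≥0}
    (h : HasCompetitiveRatio A.cost c) : 1 ≤ c := by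
  obtain ⟨e, he, hc⟩ := h
  by_contra! hlt
  have hlt' : (c : ℝ) < 1 := by exact_mod_cast hlt
  have h1 := he.def (show (0 : ℝ) < (1 - c) / 2 by linarith)
  obtain ⟨n, hn, hn'⟩ := (h1.and (Filter.eventually_gt_atTop 0)).exists
  have h2 := (A.ofReal_le_cost p n).trans (hc p n hn')
  rw [Real.norm_eq_abs, Real.norm_eq_abs, abs_of_pos hn'] at hn
  have h3 := le_abs_self (e n)
  rw [ENNReal.ofReal_le_ofReal_iff'] at h2
  rcases h2 with h2 | h2
  · nlinarith
  · linarith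

/-- One of the `(w + 1) * (m + 1)` averaged terms saves `n / 2`. By `hm`, the largest scale exceeds
the cost of exploring every path up to `n`, as `exists_cost_add_le` requires. -/
theorem randomizedRatio_le_sub {w lam : ℕ} (hw : lam < w + 1) (A : Exploration (w + 1) lam)
    {c : ℝ≥0} (h : HasCompetitiveRatio A.cost c) {C : ℝ} (hC : 0 < C) (hcC : c ≤ C) {m : ℕ}
    (hm : C + 1 < (1 + 1 / (2 * C)) ^ (m + 1)) :
    randomizedRatio (w + 1) lam ≤ ENNReal.ofReal (c - 1 / (2 * ((w + 1) * (m + 1)))) := by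
  obtain ⟨e, he, hc⟩ := h
  -- Small enough that `(c - 1) * q ≤ c - 1 / 2` whenever `c ≤ C`.
  set q : ℝ≥0 := ⟨1 + 1 / (2 * C), by positivity⟩ with hq
  have hqv : (q : ℝ) = 1 + 1 / (2 * C) := rfl
  have hq1 : (1 : ℝ) ≤ q := by rw [hqv]; have : 0 < 1 / (2 * C) := by positivity
                               linarith
  have hq0 : (0 : ℝ) < q := by linarith
  set W : ℝ := (w + 1) * (m + 1) with hW
  have hW1 : 1 ≤ W := by
    have h1 : (0 : ℝ) ≤ w := by positivity
    have h2 : (0 : ℝ) ≤ m := by positivity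
    nlinarith
  -- The range goes up to `m + 1` because the exceptional term at scale `i ≤ m` is bounded through
  -- scale `i + 1`.
  set E : ℝ → ℝ := fun n => ∑ j ∈ Finset.range (m + 2), |e (q ^ j * n)| with hE
  have hEo : E =o[Filter.atTop] fun n : ℝ => n := by
    suffices h : ∀ j ∈ Finset.range (m + 2),
        (fun n : ℝ => |e (q ^ j * n)|) =o[Filter.atTop] fun n : ℝ => n by
      simpa only [hE] using Asymptotics.IsLittleO.fun_sum h
    intro j _
    have ht : Filter.Tendsto (fun n : ℝ => (q : ℝ) ^ j * n) Filter.atTop Filter.atTop :=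
      Filter.tendsto_id.const_mul_atTop (by positivity)
    exact ((he.comp_tendsto ht).trans_isBigO
      (Asymptotics.isBigO_const_mul_self ((q : ℝ) ^ j) (fun n : ℝ => n) _)).abs_left
  obtain ⟨N, hN⟩ := Filter.eventually_atTop.1 (he.def one_pos)
  -- For `n < N` no saving is available; the extra `n` makes up for it, since `1 / (2 * W) ≤ 1`.
  have hE' : (fun n => E n + if n < N then n else 0) =o[Filter.atTop] fun n : ℝ => n := by
    refine hEo.add ((Asymptotics.isLittleO_zero (fun n : ℝ => n) Filter.atTop).congr' ?_
      Filter.EventuallyEq.rfl)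
    filter_upwards [Filter.eventually_ge_atTop N] with n hn
    simp [not_lt.2 hn]
  refine iInf₂_le (Real.toNNReal (c - 1 / (2 * W))) ⟨A.shuffle m q⁻¹, _, hE', fun p n hn => ?_⟩
  set x : ℕ → ℝ := fun j => q ^ j * n with hx
  have hxpos : ∀ j, 0 < x j := fun j => by positivity
  have hfin : ∀ p j, A.cost p (x j) ≠ ⊤ := fun p j =>
    ((hc p (x j) (hxpos j)).trans_lt ENNReal.ofReal_lt_top).ne
  have heE : ∀ j < m + 2, |e (x j)| ≤ E n := fun j hj =>
    Finset.single_le_sum (f := fun j => |e (q ^ j * n)|) (fun _ _ => abs_nonneg _)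
      (Finset.mem_range.2 hj)
  set v : Fin (w + 1) → ℕ → ℝ := fun p j => ((q : ℝ)⁻¹) ^ j * (A.cost p (x j)).toReal with hv
  have hqinv : ∀ j, (0 : ℝ) ≤ ((q : ℝ)⁻¹) ^ j ∧ ((q : ℝ)⁻¹) ^ j ≤ 1 := fun j =>
    ⟨by positivity, pow_le_one₀ (by positivity) (inv_le_one_of_one_le₀ hq1)⟩
  have hqx : ∀ j, ((q : ℝ)⁻¹) ^ j * x j = n := fun j => by
    simp only [hx]
    rw [← mul_assoc, ← mul_pow, inv_mul_cancel₀ hq0.ne', one_pow, one_mul]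
  have hcn : 0 ≤ (c : ℝ) * n := by positivity
  have hv1 : ∀ p, ∀ j < m + 2, v p j ≤ c * n + E n := by
    intro p j hj
    have h1 : (A.cost p (x j)).toReal ≤ c * x j + |e (x j)| := by
      refine ENNReal.toReal_le_of_le_ofReal (by have := hxpos j; positivity)
        ((hc p (x j) (hxpos j)).trans (ENNReal.ofReal_le_ofReal ?_))
      have := le_abs_self (e (x j))
      linarith
    calc v p j ≤ ((q : ℝ)⁻¹) ^ j * (c * x j + |e (x j)|) :=
          mul_le_mul_of_nonneg_left h1 (hqinv j).1
      _ = c * (((q : ℝ)⁻¹) ^ j * x j) + ((q : ℝ)⁻¹) ^ j * |e (x j)| := by ring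
      _ ≤ c * n + 1 * E n := by
        rw [hqx]
        gcongr
        · exact (hqinv j).2
        · exact heE j hj
      _ = _ := by ring
  have hbound : (A.shuffle m q⁻¹).cost p n ≤
      ENNReal.ofReal (W⁻¹ * ∑ p, ∑ j ∈ Finset.range (m + 1), v p j) := by
    have h1 := A.cost_shuffle_le m q⁻¹ (by exact_mod_cast inv_pos.2 hq0) p n
      (fun p i => by simpa using hfin p i)
    refine h1.trans (le_of_eq ?_)
    have hWc : (((w + 1) * (m + 1) : ℕ) : ℝ≥0∞) = ENNReal.ofReal W := by
      rw [← ENNReal.ofReal_natCast]; push_cast; rfl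
    rw [ENNReal.ofReal_mul (by positivity), hWc, ENNReal.ofReal_inv_of_pos (by linarith),
      ENNReal.ofReal_sum_of_nonneg (fun p _ => Finset.sum_nonneg fun j _ => by positivity)]
    congr 1
    refine Finset.sum_congr rfl fun p _ => ?_
    rw [ENNReal.ofReal_sum_of_nonneg (fun j _ => by positivity)]
    refine Finset.sum_congr rfl fun j _ => ?_
    rw [hv, ENNReal.ofReal_mul (hqinv j).1, ENNReal.ofReal_toReal (hfin p j)]
    simp only [inv_inv]
    congr 1
    rw [← NNReal.coe_inv, ← NNReal.coe_pow, ENNReal.ofReal_coe_nnreal]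
  refine hbound.trans (ENNReal.ofReal_le_ofReal ?_)
  have hsum : ∀ u : ℝ, ∑ _p : Fin (w + 1), ∑ _j ∈ Finset.range (m + 1), u = W * u := by
    intro u
    simp [hW]
    ring
  have hcoe : (c : ℝ) - 1 / (2 * W) ≤ (Real.toNNReal (c - 1 / (2 * W)) : ℝ) :=
    Real.le_coe_toNNReal _
  have hWh : 1 / (2 * W) ≤ 1 := by
    rw [div_le_one (by positivity)]; linarith
  split_ifs with hnN
  · have h1 : ∑ p, ∑ j ∈ Finset.range (m + 1), v p j ≤ W * (c * n + E n) := by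
      rw [← hsum]
      refine Finset.sum_le_sum fun p _ => Finset.sum_le_sum fun j hj => hv1 p j ?_
      have := Finset.mem_range.1 hj
      omega
    have h2 : W⁻¹ * ∑ p, ∑ j ∈ Finset.range (m + 1), v p j ≤ c * n + E n := by
      rw [inv_mul_le_iff₀ (by linarith)]
      exact h1
    nlinarith
  · rw [not_lt] at hnN
    obtain ⟨p₀, i, him, hi⟩ := A.exists_cost_add_le hw x (m + 1) hfin (fun p => by
      refine (hc p (x 0) (hxpos 0)).trans_lt ((ENNReal.ofReal_lt_ofReal_iff (hxpos _)).2 ?_)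
      have h1 := hN n hnN
      rw [Real.norm_eq_abs, Real.norm_eq_abs, abs_of_pos hn] at h1
      have h2 := le_abs_self (e n)
      simp only [hx, pow_zero, one_mul]
      calc (c : ℝ) * n + e n ≤ (C + 1) * n := by nlinarith
        _ < _ := mul_lt_mul_of_pos_right hm hn)
    have hv2 : v p₀ i ≤ c * n + E n - n / 2 := by
      have h1 : (A.cost p₀ (x i)).toReal + x (i + 1) ≤ c * x (i + 1) + |e (x (i + 1))| := by
        have h2 := hi.trans (hc p₀ _ (hxpos (i + 1)))
        rw [← ENNReal.ofReal_toReal (hfin p₀ i), ← ENNReal.ofReal_add ENNReal.toReal_nonneg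
          (hxpos _).le, ENNReal.ofReal_le_ofReal_iff'] at h2
        have h3 := le_abs_self (e (x (i + 1)))
        have h4 : 0 ≤ (A.cost p₀ (x i)).toReal := ENNReal.toReal_nonneg
        have h5 := hxpos (i + 1)
        rcases h2 with h2 | h2 <;> linarith
      have h6 : x (i + 1) = q * x i := by simp only [hx, pow_succ]; ring
      calc v p₀ i ≤ ((q : ℝ)⁻¹) ^ i * ((c - 1) * x (i + 1) + |e (x (i + 1))|) :=
            mul_le_mul_of_nonneg_left (by linarith) (hqinv i).1
        _ = (c - 1) * q * (((q : ℝ)⁻¹) ^ i * x i) + ((q : ℝ)⁻¹) ^ i * |e (x (i + 1))| := by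
            rw [h6]; ring
        _ ≤ (c - 1 / 2) * n + 1 * E n := by
          rw [hqx]
          gcongr
          · have h7 : (1 / (2 * C)) * c ≤ 1 / 2 := by
              rw [div_mul_eq_mul_div, div_le_div_iff₀ (by positivity) (by norm_num)]
              linarith
            have h8 : 0 < 1 / (2 * C) := by positivity
            rw [hqv]
            nlinarith
          · exact (hqinv i).2
          · exact heE _ (by omega)
        _ = _ := by ring
    have h1 : ∑ p, ∑ j ∈ Finset.range (m + 1), v p j ≤ W * (c * n + E n) - n / 2 := by
      rw [← hsum, ← Finset.sum_product', ← Finset.sum_product',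
        ← Finset.add_sum_erase _ _ (show (p₀, i) ∈ _ from
          Finset.mk_mem_product (Finset.mem_univ _) (Finset.mem_range.2 him)),
        ← Finset.add_sum_erase _ (fun _ => (c : ℝ) * n + E n) (show (p₀, i) ∈ _ from
          Finset.mk_mem_product (Finset.mem_univ _) (Finset.mem_range.2 him))]
      have h2 : ∑ y ∈ (Finset.univ ×ˢ Finset.range (m + 1)).erase (p₀, i), v y.1 y.2 ≤
          ∑ y ∈ (Finset.univ ×ˢ Finset.range (m + 1)).erase (p₀, i), (c * n + E n) := by
        refine Finset.sum_le_sum fun y hy => hv1 _ _ ?_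
        have := Finset.mem_range.1 (Finset.mem_product.1 (Finset.mem_of_mem_erase hy)).2
        omega
      linarith
    calc W⁻¹ * ∑ p, ∑ j ∈ Finset.range (m + 1), v p j ≤ W⁻¹ * (W * (c * n + E n) - n / 2) := by
          gcongr
      _ = (c - 1 / (2 * W)) * n + (E n + 0) := by field_simp; ring
      _ ≤ _ := by gcongr

theorem randomizedRatio_lt_deterministicRatio {w lam : ℕ} (hlam : 1 ≤ lam) (hw : lam < w) :
    randomizedRatio w lam < deterministicRatio w lam := by
  obtain ⟨w, rfl⟩ : ∃ v, w = v + 1 := ⟨w - 1, by omega⟩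
  have hD := deterministicRatio_lt_top hlam (show 1 ≤ w + 1 by omega)
  have hD1 : 1 ≤ deterministicRatio (w + 1) lam := le_iInf₂ fun c ⟨A, hA⟩ => by
    exact_mod_cast one_le_of_hasCompetitiveRatio A 0 hA
  set D := deterministicRatio (w + 1) lam
  -- `C`, and with it `m` and `δ`, is fixed before the algorithm; then `c < D + δ` with `δ ≤ 1`
  -- ensures `c ≤ C`.
  set C : ℝ := D.toReal + 1
  have hC : 0 < C := by positivity
  obtain ⟨m, hm⟩ := pow_unbounded_of_one_lt (C + 1)
    (show 1 < 1 + 1 / (2 * C) by have : 0 < 1 / (2 * C) := by positivity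
                                 linarith)
  have hm' : C + 1 < (1 + 1 / (2 * C)) ^ (m + 1) := hm.trans_le
    (pow_le_pow_right₀ (by have : 0 < 1 / (2 * C) := by positivity
                           linarith) (by omega))
  set δ : ℝ := 1 / (2 * ((w + 1) * (m + 1)))
  have hδ : 0 < δ := by positivity
  have hδ1 : δ ≤ 1 := by
    rw [div_le_one (by positivity)]
    have h1 : (0 : ℝ) ≤ w := by positivity
    have h2 : (0 : ℝ) ≤ m := by positivity
    nlinarith
  have hlt : D < D + ENNReal.ofReal δ :=
    ENNReal.lt_add_right hD.ne (by simpa using hδ)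
  obtain ⟨c, hc⟩ := iInf_lt_iff.1 (show (⨅ (c : ℝ≥0) (_ : ∃ A : Exploration (w + 1) lam,
    HasCompetitiveRatio A.cost c), (c : ℝ≥0∞)) < D + ENNReal.ofReal δ from hlt)
  obtain ⟨⟨A, hA⟩, hc⟩ := iInf_lt_iff.1 hc
  rw [← ENNReal.ofReal_toReal hD.ne, ← ENNReal.ofReal_add ENNReal.toReal_nonneg hδ.le,
    ← ENNReal.ofReal_coe_nnreal, ENNReal.ofReal_lt_ofReal_iff (by positivity)] at hc
  refine (randomizedRatio_le_sub hw A hA hC (by simp only [C]; linarith) hm').trans_lt ?_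
  rw [← ENNReal.ofReal_toReal hD.ne]
  refine (ENNReal.ofReal_lt_ofReal_iff (ENNReal.toReal_pos (by positivity) hD.ne)).2 ?_
  linarith

/-! ### The lower bound `w` for randomized algorithms -/

/-- Each ordered pair or its reverse is counted, by totality; add the double sum to its transpose.
-/
theorem card_sq_le_two_mul_sum_le {α β : Type*} [LinearOrder α] (s : Finset β) (τ : β → α) :
    s.card ^ 2 ≤ 2 * ∑ a ∈ s, ∑ b ∈ s, if τ b ≤ τ a then 1 else 0 := by
  rw [two_mul]
  nth_rewrite 2 [Finset.sum_comm]
  rw [← Finset.sum_add_distrib]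
  simp only [← Finset.sum_add_distrib]
  calc s.card ^ 2 = ∑ a ∈ s, ∑ b ∈ s, 1 := by simp [sq]
    _ ≤ _ := Finset.sum_le_sum fun a _ => Finset.sum_le_sum fun b _ => by
      rcases le_total (τ a) (τ b) with h | h <;> simp [h]

theorem ofReal_sum_le_sum_ofReal {β : Type*} (s : Finset β) (f : β → ℝ) :
    ENNReal.ofReal (∑ b ∈ s, f b) ≤ ∑ b ∈ s, ENNReal.ofReal (f b) :=
  Finset.le_sum_of_subadditive _ ENNReal.ofReal_zero.le (fun _ _ => ENNReal.ofReal_add_le) _ _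

namespace Exploration

variable {w lam : ℕ}

/-- The time when some robot first passes beyond distance `x` on path `p`. -/
noncomputable def passTime (A : Exploration w lam) (p : Fin w) (x : ℝ) : ℝ≥0∞ :=
  ⨅ (k : Fin lam) (i : ℕ), if x < A.pos k (TopologicalSpace.denseSeq ℝ≥0 i) p then
    (TopologicalSpace.denseSeq ℝ≥0 i : ℝ≥0∞) else ⊤

theorem exists_of_passTime_lt (A : Exploration w lam) {p : Fin w} {x : ℝ} {t : ℝ≥0}
    (h : A.passTime p x < t) : ∃ s ≤ t, ∃ k, x < A.pos k s p := by
  simp only [passTime, iInf_lt_iff] at h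
  obtain ⟨k, i, h⟩ := h
  split_ifs at h with hx
  · exact ⟨_, by exact_mod_cast h.le, k, hx⟩
  · exact absurd h (by simp)

theorem passTime_lt (A : Exploration w lam) {p : Fin w} {x : ℝ} {t : ℝ≥0} {k : Fin lam}
    (hx : 0 ≤ x) (h : x < A.pos k t p) : A.passTime p x < t := by
  have hcont := A.continuous_pos_apply k p
  -- The midpoint provides a time strictly before `t` already beyond `x`; nearby, the dense sequence
  -- has such a time too.
  obtain ⟨s, hs, hsy⟩ := intermediate_value_Icc (zero_le (a := t)) hcont.continuousOn
    (show (x + A.pos k t p) / 2 ∈ Set.Icc _ _ from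
      ⟨by rw [A.start]; linarith, by linarith⟩)
  have hst : s < t := lt_of_le_of_ne hs.2 (by rintro rfl; simp only at hsy; linarith)
  have hopen : IsOpen (Set.Iio t ∩ {s | x < A.pos k s p}) :=
    isOpen_Iio.inter (isOpen_lt continuous_const hcont)
  obtain ⟨_, ⟨hr, hr'⟩, i, rfl⟩ := (TopologicalSpace.denseRange_denseSeq ℝ≥0).inter_open_nonempty _
    hopen ⟨s, hst, show x < A.pos k s p by simp only at hsy; linarith⟩
  have hr' : x < A.pos k (TopologicalSpace.denseSeq ℝ≥0 i) p := hr'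
  refine lt_of_le_of_lt (iInf₂_le k i) ?_
  rw [if_pos hr']
  exact_mod_cast hr

/-- The number of `l < m` for which path `j` has been explored beyond `x l` when path `i` has been
explored beyond `x k`. -/
noncomputable def passCount (A : Exploration w lam) (x : ℕ → ℝ) (m : ℕ) (i : Fin w) (k : ℕ)
    (j : Fin w) : ℕ :=
  ∑ l ∈ Finset.range m, if A.passTime j (x l) ≤ A.passTime i (x k) then 1 else 0

/-- Level `k` on path `i` is passed strictly before the goal at level `k + 1` is found. If `L > 0`
levels are counted on path `j`, one of them has index at least `L - 1`. Subtracting `X` makes the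
term nonpositive when `L = 0`. -/
theorem sum_ofReal_le_cost (A : Exploration w lam) {X h : ℝ} (hX : 0 < X) (hh : 0 < h) (m : ℕ)
    (i : Fin w) (k : ℕ) :
    ∑ j, ENNReal.ofReal (X * (Real.exp (h * ((A.passCount
      (fun k => X * Real.exp (h * k)) m i k j : ℝ) - 1)) - 1)) ≤
      A.cost i (X * Real.exp (h * (k + 1 : ℕ))) := by
  set x : ℕ → ℝ := fun k => X * Real.exp (h * k) with hx
  refine le_iInf₂ fun t ⟨r, hr⟩ => A.sum_le_traveled t _ fun j => ?_
  have ht : A.passTime i (x k) < t := by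
    refine A.passTime_lt (k := r) (by positivity) ?_
    rw [hr]
    have : (k : ℝ) < (k + 1 : ℕ) := by push_cast; linarith
    exact mul_lt_mul_of_pos_left (Real.exp_lt_exp.2 (mul_lt_mul_of_pos_left this hh)) hX
  set S := (Finset.range m).filter fun l => A.passTime j (x l) ≤ A.passTime i (x k) with hS
  have hL : A.passCount x m i k j = S.card := by
    rw [passCount, hS, Finset.card_filter]
  rcases Nat.eq_zero_or_pos S.card with h0 | h0
  · left
    rw [hL, h0]
    refine mul_nonpos_of_nonneg_of_nonpos hX.le (sub_nonpos.2 (Real.exp_le_one_iff.2 ?_))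
    push_cast
    linarith
  · right
    obtain ⟨l, hl, hle⟩ : ∃ l ∈ S, S.card ≤ l + 1 := by
      by_contra! hcon
      have : S ⊆ Finset.range (S.card - 1) := fun l hl => by
        have := hcon l hl
        exact Finset.mem_range.2 (by omega)
      have := Finset.card_le_card this
      rw [Finset.card_range] at this
      omega
    obtain ⟨s, hs, r', hr'⟩ :=
      A.exists_of_passTime_lt ((Finset.mem_filter.1 hl).2.trans_lt ht)
    refine ⟨s, hs, r', le_trans ?_ hr'.le⟩
    rw [hL, hx]
    have h1 : (S.card : ℝ) - 1 ≤ l := by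
      have : (S.card : ℝ) ≤ l + 1 := by exact_mod_cast hle
      linarith
    have h2 : Real.exp (h * ((S.card : ℝ) - 1)) ≤ Real.exp (h * l) := by gcongr
    exact mul_le_mul_of_nonneg_left (by linarith) hX.le

/-- With `L` the count, `exp (-(h * k)) * exp (h * (L - 1))` equals `exp (-h) * exp (h * (L - k))`,
at least `exp (-h) * (1 + h * (L - k))`. The sum of `L - k` is nonnegative: pair counting gives at
least `(w * m) ^ 2 / 2` for `L`, while `k` contributes at most that. -/
theorem le_sum_exp_passCount (A : Exploration w lam) {h : ℝ} (hh : 0 < h) (x : ℕ → ℝ) (m : ℕ) :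
    w ^ 2 * (Real.exp (-h) * m - ∑ k ∈ Finset.range m, Real.exp (-(h * k))) ≤
      ∑ i, ∑ k ∈ Finset.range m, Real.exp (-(h * k)) *
        ∑ j, (Real.exp (h * ((A.passCount x m i k j : ℝ) - 1)) - 1) := by
  have hcount : (w * m) ^ 2 ≤ 2 * ∑ i, ∑ k ∈ Finset.range m, ∑ j, A.passCount x m i k j := by
    have := card_sq_le_two_mul_sum_le ((Finset.univ : Finset (Fin w)) ×ˢ Finset.range m)
      fun a => A.passTime a.1 (x a.2)
    simpa only [Finset.card_product, Finset.card_univ, Fintype.card_fin, Finset.card_range,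
      Finset.sum_product, passCount] using this
  have hcount' : ((w : ℝ) * m) ^ 2 ≤
      2 * ∑ i, ∑ k ∈ Finset.range m, ∑ j, (A.passCount x m i k j : ℝ) := by
    exact_mod_cast hcount
  have hid : 2 * ∑ k ∈ Finset.range m, (k : ℝ) ≤ (m : ℝ) ^ 2 := by
    have h1 := Finset.sum_range_id_mul_two m
    have h2 : (∑ k ∈ Finset.range m, k) * 2 ≤ m ^ 2 := by
      rw [h1, sq]
      exact Nat.mul_le_mul_left _ (Nat.sub_le _ _)
    have h3 : (∑ k ∈ Finset.range m, (k : ℝ)) * 2 ≤ (m : ℝ) ^ 2 := by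
      simpa using (Nat.cast_le (α := ℝ)).2 h2
    linarith
  have hterm : ∀ i k j, Real.exp (-h) * (1 + h * (A.passCount x m i k j - k)) -
      Real.exp (-(h * k)) ≤
      Real.exp (-(h * k)) * (Real.exp (h * ((A.passCount x m i k j : ℝ) - 1)) - 1) := by
    intro i k j
    have h1 := Real.add_one_le_exp (h * ((A.passCount x m i k j : ℝ) - k))
    have h2 : Real.exp (-(h * k)) * Real.exp (h * ((A.passCount x m i k j : ℝ) - 1)) =
        Real.exp (-h) * Real.exp (h * ((A.passCount x m i k j : ℝ) - k)) := by
      rw [← Real.exp_add, ← Real.exp_add]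
      congr 1
      ring
    rw [mul_sub (Real.exp (-(h * k))), h2, mul_one]
    have := Real.exp_pos (-h)
    nlinarith
  calc _ ≤ ∑ i : Fin w, ∑ k ∈ Finset.range m, ∑ j : Fin w,
        (Real.exp (-h) * (1 + h * (A.passCount x m i k j - k)) - Real.exp (-(h * k))) := by
        have hsum : ∑ i : Fin w, ∑ k ∈ Finset.range m, ∑ j : Fin w,
            (Real.exp (-h) * (1 + h * (A.passCount x m i k j - k)) - Real.exp (-(h * k))) =
            Real.exp (-h) * (w ^ 2 * m + h * (∑ i, ∑ k ∈ Finset.range m, ∑ j,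
              (A.passCount x m i k j : ℝ) - w ^ 2 * ∑ k ∈ Finset.range m, (k : ℝ))) -
              w ^ 2 * ∑ k ∈ Finset.range m, Real.exp (-(h * k)) := by
          simp only [Finset.sum_sub_distrib, Finset.sum_add_distrib, ← Finset.mul_sum,
            Finset.sum_const, Finset.card_univ, Fintype.card_fin, Finset.card_range, nsmul_eq_mul]
          ring
        rw [hsum]
        have h1 : 0 ≤ Real.exp (-h) * (h * (∑ i, ∑ k ∈ Finset.range m, ∑ j,
              (A.passCount x m i k j : ℝ) - w ^ 2 * ∑ k ∈ Finset.range m, (k : ℝ))) := by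
          refine mul_nonneg (Real.exp_pos _).le (mul_nonneg hh.le ?_)
          have := mul_le_mul_of_nonneg_left hid (sq_nonneg (w : ℝ))
          linarith [mul_pow (w : ℝ) m 2]
        linarith
    _ ≤ _ := by
        refine Finset.sum_le_sum fun i _ => Finset.sum_le_sum fun k _ => ?_
        rw [Finset.mul_sum]
        exact Finset.sum_le_sum fun j _ => hterm i k j

end Exploration

namespace RandomizedExploration

variable {w lam : ℕ}

/-- Here the dense sequence of times pays off: the infimum is countable. -/
theorem measurable_passTime (A : RandomizedExploration w lam) (p : Fin w) (x : ℝ) :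
    letI := A.mΩ
    Measurable fun ω => (A.run ω).passTime p x := by
  let _ := A.mΩ
  refine Measurable.iInf fun k => Measurable.iInf fun i => Measurable.ite ?_ measurable_const
    measurable_const
  exact measurableSet_lt measurable_const (A.measurable_pos k _ p)

theorem measurable_passCount (A : RandomizedExploration w lam) (x : ℕ → ℝ) (m : ℕ) (i : Fin w)
    (k : ℕ) (j : Fin w) :
    letI := A.mΩ
    Measurable fun ω => (A.run ω).passCount x m i k j := by
  let _ := A.mΩ
  refine Finset.measurable_fun_sum _ fun l _ => Measurable.ite ?_ measurable_const measurable_const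
  exact measurableSet_le (A.measurable_passTime _ _) (A.measurable_passTime _ _)

theorem le_sum_cost (A : RandomizedExploration w lam) {X h : ℝ} (hX : 0 < X) (hh : 0 < h) (m : ℕ) :
    ENNReal.ofReal (X * (w ^ 2 * (Real.exp (-h) * m -
        ∑ k ∈ Finset.range m, Real.exp (-(h * k))))) ≤
      ∑ i, ∑ k ∈ Finset.range m, ENNReal.ofReal (Real.exp (-(h * k))) *
        A.cost i (X * Real.exp (h * (k + 1 : ℕ))) := by
  let _ := A.mΩ
  have := A.isProbability
  set x : ℕ → ℝ := fun k => X * Real.exp (h * k)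
  let G : Fin w → ℕ → A.Ω → ℝ≥0∞ := fun i k ω => ∑ j, ENNReal.ofReal
    (X * (Real.exp (h * (((A.run ω).passCount x m i k j : ℝ) - 1)) - 1))
  have hG : ∀ i k, Measurable (G i k) := fun i k => Finset.measurable_fun_sum _ fun j _ =>
    (measurable_from_nat (f := fun n : ℕ => ENNReal.ofReal
      (X * (Real.exp (h * ((n : ℝ) - 1)) - 1)))).comp (A.measurable_passCount x m i k j)
  calc _ = ∫⁻ _, ENNReal.ofReal (X * (w ^ 2 * (Real.exp (-h) * m -
        ∑ k ∈ Finset.range m, Real.exp (-(h * k))))) ∂A.prob := by simp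
    _ ≤ ∫⁻ ω, ∑ i, ∑ k ∈ Finset.range m, ENNReal.ofReal (Real.exp (-(h * k))) * G i k ω
        ∂A.prob := by
      refine lintegral_mono fun ω => ?_
      refine (ENNReal.ofReal_le_ofReal (mul_le_mul_of_nonneg_left
        ((A.run ω).le_sum_exp_passCount hh x m) hX.le)).trans ?_
      rw [Finset.mul_sum]
      refine (ofReal_sum_le_sum_ofReal _ _).trans (Finset.sum_le_sum fun i _ => ?_)
      rw [Finset.mul_sum]
      refine (ofReal_sum_le_sum_ofReal _ _).trans (Finset.sum_le_sum fun k _ => ?_)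
      rw [mul_left_comm, ENNReal.ofReal_mul (Real.exp_pos _).le, Finset.mul_sum]
      exact mul_le_mul_right (ofReal_sum_le_sum_ofReal _ _) _
    _ = ∑ i, ∑ k ∈ Finset.range m, ENNReal.ofReal (Real.exp (-(h * k))) *
        ∫⁻ ω, G i k ω ∂A.prob := by
      rw [lintegral_finsetSum _ fun i _ => Finset.measurable_fun_sum _ fun k _ =>
        (hG i k).const_mul _]
      refine Finset.sum_congr rfl fun i _ => ?_
      rw [lintegral_finsetSum _ fun k _ => (hG i k).const_mul _]
      exact Finset.sum_congr rfl fun k _ => lintegral_const_mul _ (hG i k)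
    _ ≤ _ := Finset.sum_le_sum fun i _ => Finset.sum_le_sum fun k _ =>
      mul_le_mul_right (lintegral_mono fun ω => (A.run ω).sum_ofReal_le_cost hX hh m i k) _

theorem le_of_hasCompetitiveRatio (A : RandomizedExploration w lam) {c : ℝ≥0}
    (hA : HasCompetitiveRatio A.cost c) : (w : ℝ) ≤ c := by
  rcases Nat.eq_zero_or_pos w with rfl | hw
  · simp
  have hw' : (0 : ℝ) < w := by exact_mod_cast hw
  obtain ⟨e, he, hc⟩ := hA
  have main : ∀ ε > 0, ∀ h > 0, (w : ℝ) * Real.exp (-h) ≤ (c + ε) * Real.exp h := by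
    intro ε hε h hh
    obtain ⟨N, hN⟩ := Filter.eventually_atTop.1 (he.def hε)
    -- All goals lie at distance at least `N`, where the error term is at most `ε` times the
    -- distance.
    set X := max N 1
    have hX : 0 < X := lt_of_lt_of_le one_pos (le_max_right _ _)
    have hfin : ∀ m : ℕ, w ^ 2 * (Real.exp (-h) * m -
        ∑ k ∈ Finset.range m, Real.exp (-(h * k))) ≤ w * (m * ((c + ε) * Real.exp h)) := by
      intro m
      have h1 : ∑ i, ∑ k ∈ Finset.range m, ENNReal.ofReal (Real.exp (-(h * k))) *
          A.cost i (X * Real.exp (h * (k + 1 : ℕ))) ≤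
          ENNReal.ofReal (X * (w * (m * ((c + ε) * Real.exp h)))) := by
        calc _ ≤ ∑ i : Fin w, ∑ k ∈ Finset.range m,
              ENNReal.ofReal (X * ((c + ε) * Real.exp h)) := by
              refine Finset.sum_le_sum fun i _ => Finset.sum_le_sum fun k _ => ?_
              have hy : 0 < X * Real.exp (h * (k + 1 : ℕ)) := by positivity
              have hXy : N ≤ X * Real.exp (h * (k + 1 : ℕ)) :=
                (le_max_left _ _).trans (le_mul_of_one_le_right hX.le
                  (Real.one_le_exp (by positivity)))
              refine (mul_le_mul_right (hc i _ hy) _).trans ?_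
              rw [← ENNReal.ofReal_mul (Real.exp_pos _).le]
              refine ENNReal.ofReal_le_ofReal ?_
              have h2 := hN _ hXy
              rw [Real.norm_eq_abs, Real.norm_eq_abs, abs_of_pos hy] at h2
              have h3 := le_abs_self (e (X * Real.exp (h * (k + 1 : ℕ))))
              have h4 : Real.exp (-(h * k)) * Real.exp (h * (k + 1 : ℕ)) = Real.exp h := by
                rw [← Real.exp_add]
                congr 1
                push_cast
                ring
              calc _ ≤ Real.exp (-(h * k)) * ((c + ε) * (X * Real.exp (h * (k + 1 : ℕ)))) :=
                    mul_le_mul_of_nonneg_left (by linarith) (Real.exp_pos _).le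
                _ = X * ((c + ε) * (Real.exp (-(h * k)) * Real.exp (h * (k + 1 : ℕ)))) := by ring
                _ ≤ _ := by rw [h4]
          _ = _ := by
              simp only [Finset.sum_const, Finset.card_univ, Fintype.card_fin, Finset.card_range,
                nsmul_eq_mul]
              rw [← ENNReal.ofReal_natCast, ← ENNReal.ofReal_natCast (n := m),
                ← ENNReal.ofReal_mul (by positivity), ← ENNReal.ofReal_mul (by positivity)]
              congr 1
              ring
      have h5 := (A.le_sum_cost hX hh m).trans h1
      rw [ENNReal.ofReal_le_ofReal_iff (by positivity)] at h5
      exact le_of_mul_le_mul_left h5 hX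
    have hr : Real.exp (-h) < 1 := by simpa using hh
    have hgeom : ∀ m : ℕ, ∑ k ∈ Finset.range m, Real.exp (-(h * k)) ≤ (1 - Real.exp (-h))⁻¹ := by
      intro m
      rw [← tsum_geometric_of_lt_one (Real.exp_pos _).le hr]
      refine le_trans (le_of_eq ?_) ((summable_geometric_of_lt_one (Real.exp_pos _).le
        hr).sum_le_tsum (Finset.range m) fun _ _ => by positivity)
      refine Finset.sum_congr rfl fun k _ => ?_
      rw [← Real.exp_nat_mul]
      congr 1
      ring
    -- The geometric sum stays bounded in `m`, so a large `m` compares the coefficients of `m`.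
    by_contra! hlt
    obtain ⟨m, hm⟩ := exists_nat_gt (w * (1 - Real.exp (-h))⁻¹ /
      (w * Real.exp (-h) - (c + ε) * Real.exp h))
    rw [div_lt_iff₀ (by linarith)] at hm
    have h6 : w * (Real.exp (-h) * m - ∑ k ∈ Finset.range m, Real.exp (-(h * k))) ≤
        m * ((c + ε) * Real.exp h) := by
      refine le_of_mul_le_mul_left ?_ hw'
      rw [← mul_assoc, ← sq]
      exact hfin m
    have h7 := mul_le_mul_of_nonneg_left (hgeom m) hw'.le
    linarith
  refine le_of_forall_pos_le_add fun ε hε => ?_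
  have hl : Filter.Tendsto (fun h : ℝ => (w : ℝ) * Real.exp (-h)) (nhdsWithin 0 (Set.Ioi 0))
      (nhds w) := by
    have : Continuous fun h : ℝ => (w : ℝ) * Real.exp (-h) := by fun_prop
    simpa using (this.tendsto 0).mono_left nhdsWithin_le_nhds
  have hr : Filter.Tendsto (fun h : ℝ => (c + ε : ℝ) * Real.exp h) (nhdsWithin 0 (Set.Ioi 0))
      (nhds (c + ε)) := by
    have : Continuous fun h : ℝ => (c + ε : ℝ) * Real.exp h := by fun_prop
    simpa using (this.tendsto 0).mono_left nhdsWithin_le_nhds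
  exact le_of_tendsto_of_tendsto hl hr
    (eventually_nhdsWithin_of_forall fun h hh => main ε hε h hh)

end RandomizedExploration

theorem natCast_le_randomizedRatio (w lam : ℕ) : (w : ℝ≥0∞) ≤ randomizedRatio w lam := by
  refine le_iInf₂ fun c ⟨A, hA⟩ => ?_
  have h : ((w : ℝ≥0) : ℝ) ≤ c := by simpa using A.le_of_hasCompetitiveRatio hA
  exact_mod_cast h

theorem mainTheorem5 (w lam : ℕ) (hlam : 1 ≤ lam) (hw : lam ≤ w) :
    deterministicRatio w lam < ⊤ ∧
      (randomizedRatio w lam < deterministicRatio w lam ↔ lam < w) := by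
  refine ⟨deterministicRatio_lt_top hlam (hlam.trans hw), fun h => ?_,
    randomizedRatio_lt_deterministicRatio hlam⟩
  refine lt_of_le_of_ne hw ?_
  rintro rfl
  exact absurd h (not_lt.2
    ((deterministicRatio_self_le lam).trans (natCast_le_randomizedRatio lam lam)))
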